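/- Let $0<k<1$, $k'=\sqrt{1-k^2}$, $K=\int_0^1\frac{dt}{\sqrt{(1-t^2)(1-k^2t^2)}}$, $K'=\int_0^1\frac{dt}{\sqrt{(1-t^2)(1-k'^2t^2)}}$. Let $\mathrm{sn}(\cdot,k)$ be the Jacobi sine function of modulus $k$, $\mathrm{ns}=1/\mathrm{sn}$, and let $\mathrm{dn}(\eta,k')=\sqrt{1-k'^2\,\mathrm{sn}^2(\eta,k')}$ for real $\eta$. Let $D=\{z\in\mathbb{C}:-K'<\operatorname{Im}z<K'\}$, and let $U$ be a complex function which is continuous on $\overline D$, holomorphic in $D$, and Hölder continuous on every bounded subset of $\partial D$ (in particular, this last condition holds if $U$ is Hölder continuous on $\partial D$). Suppose that $U(z^*)=U(z)^*$ for all $z\in D$, where $z^*$ is the complex conjugate of $z$, and write $U(x+\mathrm{i}K')=w(x)+\mathrm{i}v(x)$ for $x\in\mathbb{R}$ with $w,v$ real-valued. Then for every $x\in\mathbb{R}$ the principal-value integral and the integral below exist, and $$w(x)=\frac1\pi\,\mathrm{p.v.}\!\!\int_{x-K}^{x+K}\mathrm{ns}(x-y,k)\,v(y)\,dy+C(x),$$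 $$C(x):=\frac{k}{\pi}\int_0^{K'}\frac{1}{\mathrm{dn}(\eta,k')}\operatorname{Re}\bigl[U(x+K+\mathrm{i}\eta)+U(x-K+\mathrm{i}\eta)\bigr]\,d\eta ,$$ where the principal value is taken at the singular point $y=x$, that is, it is $\lim_{\varepsilon\to0^+}\bigl(\int_{x-K}^{x-\varepsilon}+\int_{x+\varepsilon}^{x+K}\bigr)$. In particular, if moreover $U(z+2K)=-U(z)$ for all $z\in D$, then $C(x)=0$ for every $x\in\mathbb{R}$. -/

import Mathlib

open Real Set Filter Topology MeasureTheory
open scoped NNReal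

noncomputable section

/-- The integrand `1 / √((1 - t²)(1 - k² t²))` of the elliptic integral of the first kind. -/
def ellipticIntegrand (k t : ℝ) : ℝ := 1 / √((1 - t ^ 2) * (1 - k ^ 2 * t ^ 2))

/-- The complete elliptic integral `K(k) = ∫₀¹ dt / √((1 - t²)(1 - k² t²))`. -/
def ellipticK (k : ℝ) : ℝ := ∫ t in (0 : ℝ)..1, ellipticIntegrand k t

/-- The complementary modulus `k' = √(1 - k²)`. -/
def compModulus (k : ℝ) : ℝ := √(1 - k ^ 2)

/-- `K' = K(k')`. -/
def ellipticK' (k : ℝ) : ℝ := ellipticK (compModulus k)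

/-- The incomplete elliptic integral of the first kind in Legendre's form,
`F(φ, k) = ∫₀^φ dθ / √(1 - k² sin² θ)`. -/
def ellipticF (k φ : ℝ) : ℝ := ∫ θ in (0 : ℝ)..φ, 1 / √(1 - k ^ 2 * sin θ ^ 2)

/-- Jacobi's amplitude `am(·, k) : ℝ → ℝ`, the inverse of the bijection `F(·, k)`
(for `0 < k < 1`, see `ellipticF_jacobiAm` and `jacobiAm_ellipticF`). -/
def jacobiAm (k u : ℝ) : ℝ := Function.invFun (ellipticF k) u

/-- The Jacobi function `sn(u, k)` at a real argument, `sn = sin am`.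
For `|u| ≤ K` it is the number `s` in `[-1, 1]` with `∫₀^s dt / √((1 - t²)(1 - k² t²)) = u`
(see `integral_jacobiSn`). -/
def jacobiSn (k u : ℝ) : ℝ := sin (jacobiAm k u)

/-- The Jacobi function `ns = 1 / sn`. -/
def jacobiNs (k u : ℝ) : ℝ := (jacobiSn k u)⁻¹

/-- The Jacobi function `dn(u, k) = √(1 - k² sn²(u, k))` (positive at real arguments). -/
def jacobiDn (k u : ℝ) : ℝ := √(1 - k ^ 2 * jacobiSn k u ^ 2)

/-- The open strip `D = {z : -K' < Im z < K'}`. -/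
def ellipticStrip (k : ℝ) : Set ℂ := {z : ℂ | -ellipticK' k < z.im ∧ z.im < ellipticK' k}

/-- `U` is Hölder continuous on bounded parts of `S` (with a constant and an exponent in `(0, 1]`
that may depend on the part). -/
def HolderOnBoundedParts (U : ℂ → ℂ) (S : Set ℂ) : Prop :=
  ∀ s ⊆ S, Bornology.IsBounded s → ∃ C r : ℝ≥0, 0 < r ∧ r ≤ 1 ∧ HolderOnWith C r U s

/-- The Cauchy principal value of `∫ₐᵇ f(y) dy`, with the singular point `c` in `(a, b)`,
exists and equals `L`: the integrals away from `c` exist, and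
`∫ₐ^{c-ε} f + ∫_{c+ε}^b f → L` as `ε → 0⁺`. -/
def HasPrincipalValue (f : ℝ → ℝ) (a b c L : ℝ) : Prop :=
  (∀ᶠ ε in 𝓝[>] (0 : ℝ),
    IntervalIntegrable f volume a (c - ε) ∧ IntervalIntegrable f volume (c + ε) b) ∧
  Tendsto (fun ε : ℝ => (∫ y in a..(c - ε), f y) + ∫ y in (c + ε)..b, f y) (𝓝[>] 0) (𝓝 L)

/-- The integrand `(1 / dn(η, k')) · Re [U(x + K + iη) + U(x - K + iη)]`. -/
def correctionIntegrand (k : ℝ) (U : ℂ → ℂ) (x η : ℝ) : ℝ :=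
  1 / jacobiDn (compModulus k) η *
    (U (x + ellipticK k + Complex.I * η) + U (x - ellipticK k + Complex.I * η)).re

/-- `C(x) = (k/π) ∫₀^{K'} (1 / dn(η, k')) · Re [U(x + K + iη) + U(x - K + iη)] dη`. -/
def correction (k : ℝ) (U : ℂ → ℂ) (x : ℝ) : ℝ :=
  k / π * ∫ η in (0 : ℝ)..(ellipticK' k), correctionIntegrand k U x η

/-! Checks that the amplitude is the inverse of the elliptic integral and that `sn` inverts
the integral in its algebraic form. -/

lemma legendre_pos {k : ℝ} (hk0 : 0 < k) (hk1 : k < 1) (θ : ℝ) :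
    0 < 1 - k ^ 2 * sin θ ^ 2 := by
  nlinarith [sin_sq_le_one θ, sq_nonneg (sin θ), mul_pos hk0 hk0]

lemma continuous_legendre {k : ℝ} (hk0 : 0 < k) (hk1 : k < 1) :
    Continuous fun θ : ℝ => 1 / √(1 - k ^ 2 * sin θ ^ 2) := by
  refine continuous_const.div (by fun_prop) fun θ => ?_
  exact (Real.sqrt_pos.2 (legendre_pos hk0 hk1 θ)).ne'

lemma one_le_legendre {k : ℝ} (hk0 : 0 < k) (hk1 : k < 1) (θ : ℝ) :
    1 ≤ 1 / √(1 - k ^ 2 * sin θ ^ 2) := by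
  rw [le_div_iff₀ (Real.sqrt_pos.2 (legendre_pos hk0 hk1 θ)), one_mul]
  exact Real.sqrt_le_one.2 (by nlinarith [mul_nonneg (sq_nonneg k) (sq_nonneg (sin θ))])

lemma ellipticF_sub_ge {k : ℝ} (hk0 : 0 < k) (hk1 : k < 1) {a b : ℝ} (hab : a ≤ b) :
    b - a ≤ ellipticF k b - ellipticF k a := by
  have hc := continuous_legendre hk0 hk1
  unfold ellipticF
  rw [intervalIntegral.integral_interval_sub_left (hc.intervalIntegrable _ _)
    (hc.intervalIntegrable _ _)]
  have := intervalIntegral.integral_mono_on (μ := volume) (f := fun _ => (1 : ℝ)) hab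
    (continuous_const.intervalIntegrable a b)
    (hc.intervalIntegrable a b) (fun θ _ => one_le_legendre hk0 hk1 θ)
  simpa using this

lemma bijective_ellipticF {k : ℝ} (hk0 : 0 < k) (hk1 : k < 1) :
    Function.Bijective (ellipticF k) := by
  have h0 : ellipticF k 0 = 0 := by simp [ellipticF]
  constructor
  · refine StrictMono.injective fun a b hab => ?_
    have := ellipticF_sub_ge hk0 hk1 hab.le
    linarith
  · refine Continuous.surjective ?_ ?_ ?_
    · exact intervalIntegral.continuous_primitive
        (fun a b => (continuous_legendre hk0 hk1).intervalIntegrable a b) 0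
    · refine tendsto_atTop_mono' _ ?_ tendsto_id
      filter_upwards [eventually_ge_atTop 0] with φ hφ
      have := ellipticF_sub_ge hk0 hk1 hφ
      simp only [id]; linarith
    · refine tendsto_atBot_mono' _ ?_ tendsto_id
      filter_upwards [eventually_le_atBot 0] with φ hφ
      have := ellipticF_sub_ge hk0 hk1 hφ
      simp only [id]; linarith

lemma ellipticF_jacobiAm {k : ℝ} (hk0 : 0 < k) (hk1 : k < 1) (u : ℝ) :
    ellipticF k (jacobiAm k u) = u :=
  Function.rightInverse_invFun (bijective_ellipticF hk0 hk1).2 u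

lemma jacobiAm_ellipticF {k : ℝ} (hk0 : 0 < k) (hk1 : k < 1) (φ : ℝ) :
    jacobiAm k (ellipticF k φ) = φ :=
  Function.leftInverse_invFun (bijective_ellipticF hk0 hk1).1 φ

lemma ellipticF_neg (k φ : ℝ) : ellipticF k (-φ) = -ellipticF k φ := by
  have := intervalIntegral.integral_comp_neg (a := 0) (b := φ)
    (fun θ : ℝ => 1 / √(1 - k ^ 2 * sin θ ^ 2))
  simp only [sin_neg, neg_sq, neg_zero] at this
  unfold ellipticF
  rw [this, intervalIntegral.integral_symm]

/-- The substitution `t = sin θ`. -/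
lemma integral_sin_eq_ellipticF {k φ : ℝ} (hφ0 : 0 ≤ φ) (hφ : φ ≤ π / 2) :
    ∫ t in (0 : ℝ)..(sin φ), ellipticIntegrand k t = ellipticF k φ := by
  have hs : 0 ≤ sin φ := sin_nonneg_of_nonneg_of_le_pi hφ0 (by linarith [pi_pos])
  have himg : sin '' Ioo 0 φ = Ioo 0 (sin φ) := by
    ext t
    constructor
    · rintro ⟨θ, ⟨h1, h2⟩, rfl⟩
      exact ⟨sin_pos_of_pos_of_lt_pi h1 (by linarith [pi_pos]),
        sin_lt_sin_of_lt_of_le_pi_div_two (by linarith [pi_pos]) hφ h2⟩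
    · rintro ⟨h1, h2⟩
      have h3 : t ≤ 1 := h2.le.trans (sin_le_one _)
      refine ⟨arcsin t, ⟨arcsin_pos.2 h1, ?_⟩, sin_arcsin (by linarith) h3⟩
      rw [arcsin_lt_iff_lt_sin ⟨by linarith, h3⟩ ⟨by linarith [pi_pos], hφ⟩]
      exact h2
  have hinj : InjOn sin (Ioo 0 φ) := injOn_sin.mono fun θ h =>
    mem_Icc.2 ⟨by linarith [h.1, pi_pos], by linarith [h.2]⟩
  have key := integral_image_eq_integral_abs_deriv_smul (measurableSet_Ioo (a := (0 : ℝ)) (b := φ))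
    (fun θ _ => (hasDerivAt_sin θ).hasDerivWithinAt) hinj (ellipticIntegrand k)
  rw [himg] at key
  unfold ellipticF
  rw [intervalIntegral.integral_of_le hs, intervalIntegral.integral_of_le hφ0,
    integral_Ioc_eq_integral_Ioo, integral_Ioc_eq_integral_Ioo, key]
  refine setIntegral_congr_fun measurableSet_Ioo fun θ h => ?_
  have hc : 0 < cos θ := cos_pos_of_mem_Ioo ⟨by linarith [h.1, pi_pos], by linarith [h.2]⟩
  have h1 : 1 - sin θ ^ 2 = cos θ ^ 2 := by linarith [sin_sq_add_cos_sq θ]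
  simp only [ellipticIntegrand, smul_eq_mul, h1]
  rw [Real.sqrt_mul (sq_nonneg _), Real.sqrt_sq hc.le, abs_of_pos hc]
  field_simp

lemma integral_ellipticIntegrand_neg (k s : ℝ) :
    ∫ t in (0 : ℝ)..(-s), ellipticIntegrand k t = -∫ t in (0 : ℝ)..s, ellipticIntegrand k t := by
  have := intervalIntegral.integral_comp_neg (a := 0) (b := s) (ellipticIntegrand k)
  simp only [ellipticIntegrand, neg_sq, neg_zero] at this ⊢
  rw [this, intervalIntegral.integral_symm]

lemma ellipticK_eq (k : ℝ) : ellipticK k = ellipticF k (π / 2) := by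
  rw [← integral_sin_eq_ellipticF (by positivity) le_rfl, sin_pi_div_two, ellipticK]

/-- On `[-K, K]` the function `sn` is the inverse of the algebraic elliptic integral. -/
lemma integral_jacobiSn {k : ℝ} (hk0 : 0 < k) (hk1 : k < 1) {u : ℝ}
    (hu : |u| ≤ ellipticK k) :
    ∫ t in (0 : ℝ)..(jacobiSn k u), ellipticIntegrand k t = u := by
  have hF := ellipticF_jacobiAm hk0 hk1 u
  have hmono : StrictMono (ellipticF k) := fun a b hab => by
    have := ellipticF_sub_ge hk0 hk1 hab.le
    linarith
  rw [ellipticK_eq, abs_le, ← ellipticF_neg] at hu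
  nth_rewrite 1 2 [← hF] at hu
  rw [hmono.le_iff_le, hmono.le_iff_le] at hu
  unfold jacobiSn
  rcases le_total 0 (jacobiAm k u) with h | h
  · rw [integral_sin_eq_ellipticF h hu.2, hF]
  · have h1 := integral_sin_eq_ellipticF (k := k) (φ := -jacobiAm k u) (by linarith)
      (by linarith [hu.1])
    rw [sin_neg, integral_ellipticIntegrand_neg, ellipticF_neg, hF] at h1
    linarith

end

/-! Integrate f(z) = k sn(z, k) U(x + z) counterclockwise around the rectangle [-K, K] × [0, K'],
with a small square of half-width ε cut out below the pole iK', and take imaginary parts. The bottom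
side is real, since sn is real on ℝ and U is real there by reflection symmetry
(`im_stripIntegrand_ofReal`). On the top side k sn(t + iK') = ns t, so with y = x + t it yields the
truncated integrals of ns(x - y) v(y). On the vertical sides sn(±K + iη) = ±1/dn(η, k'), and they
contribute πC(x) (`im_sides_stripIntegrand`). Since k sn has a simple pole with residue 1 at iK'
(`tendsto_sub_mul_complexSn`), the indentation tends to the half residue πi U(x + iK')
(`tendsto_indentIntegral`), whose imaginary part is πw(x). Cauchy's theorem
(`integral_indented_rect`) is an exact identity for each small ε, so the limit ε → 0 gives the
existence and the value of the principal value together.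

No general theory of elliptic functions enters. The complex sn is defined by its expression in real
Jacobi functions of Re z and Im z, and holomorphy is the Cauchy-Riemann equation for that expression
(`sn_cauchyRiemann`), which is purely algebraic once the derivatives of the real functions are
known. Only its behaviour on the closed rectangle is used. -/

/-! ### Real Jacobi functions: derivatives, special values, signs. -/

lemma strictMono_ellipticF {k : ℝ} (hk0 : 0 < k) (hk1 : k < 1) : StrictMono (ellipticF k) :=
  fun a b hab => by
    have := ellipticF_sub_ge hk0 hk1 hab.le
    linarith

lemma strictMono_jacobiAm {k : ℝ} (hk0 : 0 < k) (hk1 : k < 1) : StrictMono (jacobiAm k) :=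
  fun a b hab => by
    rwa [← (strictMono_ellipticF hk0 hk1).lt_iff_lt, ellipticF_jacobiAm hk0 hk1,
      ellipticF_jacobiAm hk0 hk1]

lemma continuous_jacobiAm {k : ℝ} (hk0 : 0 < k) (hk1 : k < 1) : Continuous (jacobiAm k) :=
  (strictMono_jacobiAm hk0 hk1).monotone.continuous_of_surjective
    fun φ => ⟨ellipticF k φ, jacobiAm_ellipticF hk0 hk1 φ⟩

/-- The Jacobi function `cn = cos am` at a real argument. -/
noncomputable def jacobiCn (k u : ℝ) : ℝ := cos (jacobiAm k u)

lemma jacobiDn_pos {k : ℝ} (hk0 : 0 < k) (hk1 : k < 1) (u : ℝ) : 0 < jacobiDn k u :=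
  Real.sqrt_pos.2 (legendre_pos hk0 hk1 _)

lemma jacobiDn_sq {k : ℝ} (hk0 : 0 < k) (hk1 : k < 1) (u : ℝ) :
    jacobiDn k u ^ 2 = 1 - k ^ 2 * jacobiSn k u ^ 2 :=
  Real.sq_sqrt (legendre_pos hk0 hk1 _).le

lemma jacobiCn_sq (k u : ℝ) : jacobiCn k u ^ 2 = 1 - jacobiSn k u ^ 2 :=
  cos_sq' _

/-- Inverse function rule: the derivative of F at am u is 1/dn u. All the other derivatives follow
from am' = dn by the chain rule. -/
lemma hasDerivAt_jacobiAm {k : ℝ} (hk0 : 0 < k) (hk1 : k < 1) (u : ℝ) :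
    HasDerivAt (jacobiAm k) (jacobiDn k u) u := by
  have hF : HasDerivAt (ellipticF k) (1 / √(1 - k ^ 2 * sin (jacobiAm k u) ^ 2)) (jacobiAm k u) :=
    (continuous_legendre hk0 hk1).integral_hasStrictDerivAt 0 _ |>.hasDerivAt
  have h := hF.of_local_left_inverse (continuous_jacobiAm hk0 hk1).continuousAt
    (one_div_pos.2 (jacobiDn_pos hk0 hk1 u)).ne'
    (Eventually.of_forall (ellipticF_jacobiAm hk0 hk1))
  simpa [jacobiDn, jacobiSn] using h

lemma hasDerivAt_jacobiSn {k : ℝ} (hk0 : 0 < k) (hk1 : k < 1) (u : ℝ) :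
    HasDerivAt (jacobiSn k) (jacobiCn k u * jacobiDn k u) u :=
  (hasDerivAt_jacobiAm hk0 hk1 u).sin

lemma hasDerivAt_jacobiCn {k : ℝ} (hk0 : 0 < k) (hk1 : k < 1) (u : ℝ) :
    HasDerivAt (jacobiCn k) (-(jacobiSn k u * jacobiDn k u)) u := by
  have := (hasDerivAt_jacobiAm hk0 hk1 u).cos
  rwa [neg_mul] at this

lemma hasDerivAt_jacobiDn {k : ℝ} (hk0 : 0 < k) (hk1 : k < 1) (u : ℝ) :
    HasDerivAt (jacobiDn k) (-(k ^ 2 * jacobiSn k u * jacobiCn k u)) u := by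
  have h := ((((hasDerivAt_jacobiSn hk0 hk1 u).pow 2).const_mul (k ^ 2)).const_sub 1).sqrt
    (legendre_pos hk0 hk1 _).ne'
  have hd := (jacobiDn_pos hk0 hk1 u).ne'
  refine h.congr_deriv ?_
  change _ / (2 * jacobiDn k u) = _
  simp only [pow_one, Nat.cast_ofNat, Nat.add_one_sub_one]
  field_simp

lemma jacobiAm_zero {k : ℝ} (hk0 : 0 < k) (hk1 : k < 1) : jacobiAm k 0 = 0 := by
  have := jacobiAm_ellipticF hk0 hk1 0
  rwa [ellipticF, intervalIntegral.integral_same] at this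

lemma jacobiAm_neg {k : ℝ} (hk0 : 0 < k) (hk1 : k < 1) (u : ℝ) :
    jacobiAm k (-u) = -jacobiAm k u := by
  rw [← jacobiAm_ellipticF hk0 hk1 (-jacobiAm k u), ellipticF_neg, ellipticF_jacobiAm hk0 hk1]

lemma jacobiAm_ellipticK {k : ℝ} (hk0 : 0 < k) (hk1 : k < 1) : jacobiAm k (ellipticK k) = π / 2 := by
  rw [ellipticK_eq, jacobiAm_ellipticF hk0 hk1]

lemma ellipticK_pos {k : ℝ} (hk0 : 0 < k) (hk1 : k < 1) : 0 < ellipticK k := by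
  rw [← (strictMono_jacobiAm hk0 hk1).lt_iff_lt, jacobiAm_zero hk0 hk1, jacobiAm_ellipticK hk0 hk1]
  positivity

lemma jacobiSn_zero {k : ℝ} (hk0 : 0 < k) (hk1 : k < 1) : jacobiSn k 0 = 0 := by
  simp [jacobiSn, jacobiAm_zero hk0 hk1]

lemma jacobiCn_zero {k : ℝ} (hk0 : 0 < k) (hk1 : k < 1) : jacobiCn k 0 = 1 := by
  simp [jacobiCn, jacobiAm_zero hk0 hk1]

lemma jacobiDn_zero {k : ℝ} (hk0 : 0 < k) (hk1 : k < 1) : jacobiDn k 0 = 1 := by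
  simp [jacobiDn, jacobiSn_zero hk0 hk1]

lemma jacobiSn_neg {k : ℝ} (hk0 : 0 < k) (hk1 : k < 1) (u : ℝ) :
    jacobiSn k (-u) = -jacobiSn k u := by
  simp [jacobiSn, jacobiAm_neg hk0 hk1]

lemma jacobiSn_ellipticK {k : ℝ} (hk0 : 0 < k) (hk1 : k < 1) : jacobiSn k (ellipticK k) = 1 := by
  simp [jacobiSn, jacobiAm_ellipticK hk0 hk1]

lemma jacobiCn_ellipticK {k : ℝ} (hk0 : 0 < k) (hk1 : k < 1) : jacobiCn k (ellipticK k) = 0 := by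
  simp [jacobiCn, jacobiAm_ellipticK hk0 hk1]

lemma jacobiCn_neg {k : ℝ} (hk0 : 0 < k) (hk1 : k < 1) (u : ℝ) :
    jacobiCn k (-u) = jacobiCn k u := by
  simp [jacobiCn, jacobiAm_neg hk0 hk1]

lemma abs_jacobiAm_lt {k : ℝ} (hk0 : 0 < k) (hk1 : k < 1) {u : ℝ} (h : |u| < ellipticK k) :
    |jacobiAm k u| < π / 2 := by
  rw [abs_lt] at h ⊢
  rw [← jacobiAm_ellipticK hk0 hk1, ← jacobiAm_neg hk0 hk1]
  exact ⟨strictMono_jacobiAm hk0 hk1 h.1, strictMono_jacobiAm hk0 hk1 h.2⟩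

lemma jacobiCn_pos {k : ℝ} (hk0 : 0 < k) (hk1 : k < 1) {u : ℝ} (h : |u| < ellipticK k) :
    0 < jacobiCn k u :=
  cos_pos_of_mem_Ioo (abs_lt.1 (abs_jacobiAm_lt hk0 hk1 h))

lemma jacobiSn_ne_zero {k : ℝ} (hk0 : 0 < k) (hk1 : k < 1) {u : ℝ} (hu : u ≠ 0)
    (h : |u| ≤ ellipticK k) : jacobiSn k u ≠ 0 := by
  rcases h.lt_or_eq with h | h
  · have h' := abs_lt.1 (abs_jacobiAm_lt hk0 hk1 h)
    refine fun h0 => hu ((strictMono_jacobiAm hk0 hk1).injective ?_)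
    rw [jacobiAm_zero hk0 hk1]
    exact (sin_eq_zero_iff_of_lt_of_lt (by linarith [pi_pos]) (by linarith [pi_pos])).1 h0
  · rcases abs_choice u with h1 | h1
    · rw [← h1, h, jacobiSn_ellipticK hk0 hk1]; exact one_ne_zero
    · rw [← neg_neg u, ← h1, h, jacobiSn_neg hk0 hk1, jacobiSn_ellipticK hk0 hk1]; norm_num

lemma compModulus_pos {k : ℝ} (hk0 : 0 < k) (hk1 : k < 1) : 0 < compModulus k :=
  Real.sqrt_pos.2 (by nlinarith)

lemma compModulus_sq {k : ℝ} (hk0 : 0 < k) (hk1 : k < 1) : compModulus k ^ 2 = 1 - k ^ 2 :=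
  Real.sq_sqrt (by nlinarith)

lemma compModulus_lt_one {k : ℝ} (hk0 : 0 < k) (hk1 : k < 1) : compModulus k < 1 := by
  nlinarith [compModulus_sq hk0 hk1, compModulus_pos hk0 hk1]

/-! ### Holomorphy from partial derivatives. -/

/-- A real-differentiable function with partial derivatives `D` and `i D` has complex
derivative `D`. -/
lemma hasDerivAt_of_partials {f : ℂ → ℂ} {z D : ℂ} (hf : DifferentiableAt ℝ f z)
    (h1 : HasDerivAt (fun t : ℝ => f (z + t)) D 0)
    (h2 : HasDerivAt (fun t : ℝ => f (z + t * Complex.I)) (Complex.I * D) 0) :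
    HasDerivAt f D z := by
  have e1 : fderiv ℝ f z 1 = D := by
    have h : HasFDerivAt f (fderiv ℝ f z) (z + ((0 : ℝ) : ℂ)) := by simpa using hf.hasFDerivAt
    have := h.comp_hasDerivAt (0 : ℝ) (Complex.ofRealCLM.hasDerivAt.const_add z)
    simpa using this.unique h1
  have e2 : fderiv ℝ f z Complex.I = Complex.I * D := by
    have h : HasFDerivAt f (fderiv ℝ f z) (z + ((0 : ℝ) : ℂ) * Complex.I) := by
      simpa using hf.hasFDerivAt
    have := h.comp_hasDerivAt (0 : ℝ)
      ((Complex.ofRealCLM.hasDerivAt.mul_const Complex.I).const_add z)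
    simpa using this.unique h2
  have hd : DifferentiableAt ℂ f z :=
    differentiableAt_complex_iff_differentiableAt_real.2 ⟨hf, by rw [e1, e2, smul_eq_mul]⟩
  have h := hd.hasDerivAt
  have e3 : fderiv ℝ f z 1 = deriv f z := by
    rw [hd.fderiv_restrictScalars ℝ]; rfl
  rwa [← e3, e1] at h

/-- The version of `hasDerivAt_of_partials` for a function of the real and imaginary parts. -/
lemma hasDerivAt_of_partials_re_im {g : ℝ → ℝ → ℂ} {z D : ℂ}
    (hf : DifferentiableAt ℝ (fun z : ℂ => g z.re z.im) z)
    (h1 : HasDerivAt (fun u => g u z.im) D z.re)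
    (h2 : HasDerivAt (fun v => g z.re v) (Complex.I * D) z.im) :
    HasDerivAt (fun z : ℂ => g z.re z.im) D z := by
  refine hasDerivAt_of_partials hf ?_ ?_
  · simpa using HasDerivAt.comp_const_add (f := fun u => g u z.im) z.re 0 (by simpa using h1)
  · simpa using HasDerivAt.comp_const_add (f := fun v => g z.re v) z.im 0 (by simpa using h2)

/-! ### The complex function sn as an explicit quotient. -/

/-- Numerator in the expression of `sn(u + iv, k)` through Jacobi functions of real arguments. -/
noncomputable def snNum (k u v : ℝ) : ℂ :=
  jacobiSn k u * jacobiDn (compModulus k) v +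
    Complex.I * (jacobiCn k u * jacobiDn k u *
      (jacobiSn (compModulus k) v * jacobiCn (compModulus k) v))

/-- Denominator in the expression of `sn(u + iv, k)` through Jacobi functions of real arguments. -/
noncomputable def snDen (k u v : ℝ) : ℂ :=
  (jacobiCn (compModulus k) v) ^ 2 +
    k ^ 2 * (jacobiSn k u ^ 2 * jacobiSn (compModulus k) v ^ 2)

/-- Jacobi's `sn(z, k)` at a complex argument. -/
noncomputable def complexSn (k : ℝ) (z : ℂ) : ℂ := snNum k z.re z.im / snDen k z.re z.im

/-- `1 / (k sn(z, k))`, in a form without singularity at `z = i K'`. -/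
noncomputable def complexNsDiv (k : ℝ) (z : ℂ) : ℂ :=
  star (snNum k z.re z.im) / (k * ((jacobiSn k z.re ^ 2 * jacobiCn (compModulus k) z.im ^ 2 +
    jacobiSn (compModulus k) z.im ^ 2 : ℝ) : ℂ))

lemma hasDerivAt_snNum_left {k : ℝ} (hk0 : 0 < k) (hk1 : k < 1) (u v : ℝ) :
    HasDerivAt (fun u => snNum k u v)
      (jacobiCn k u * jacobiDn k u * jacobiDn (compModulus k) v -
        Complex.I * (jacobiSn k u * (jacobiDn k u ^ 2 + k ^ 2 * jacobiCn k u ^ 2) *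
          (jacobiSn (compModulus k) v * jacobiCn (compModulus k) v))) u := by
  have hs := (hasDerivAt_jacobiSn hk0 hk1 u).ofReal_comp
  have hc := (hasDerivAt_jacobiCn hk0 hk1 u).ofReal_comp
  have hd := (hasDerivAt_jacobiDn hk0 hk1 u).ofReal_comp
  refine ((hs.mul_const _).add (((hc.mul hd).mul_const _).const_mul Complex.I)).congr_deriv ?_
  push_cast
  ring

lemma hasDerivAt_snNum_right {k : ℝ} (hk0 : 0 < k) (hk1 : k < 1) (u v : ℝ) :
    HasDerivAt (fun v => snNum k u v)
      (-(jacobiSn k u * (compModulus k ^ 2 * jacobiSn (compModulus k) v *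
          jacobiCn (compModulus k) v)) +
        Complex.I * (jacobiCn k u * jacobiDn k u * (jacobiDn (compModulus k) v *
          (jacobiCn (compModulus k) v ^ 2 - jacobiSn (compModulus k) v ^ 2)))) v := by
  have h0 := compModulus_pos hk0 hk1
  have h1 := compModulus_lt_one hk0 hk1
  have hs := (hasDerivAt_jacobiSn h0 h1 v).ofReal_comp
  have hc := (hasDerivAt_jacobiCn h0 h1 v).ofReal_comp
  have hd := (hasDerivAt_jacobiDn h0 h1 v).ofReal_comp
  refine ((hd.const_mul _).add (((hs.mul hc).const_mul _).const_mul Complex.I)).congr_deriv ?_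
  push_cast
  ring

lemma hasDerivAt_snDen_left {k : ℝ} (hk0 : 0 < k) (hk1 : k < 1) (u v : ℝ) :
    HasDerivAt (fun u => snDen k u v)
      (2 * k ^ 2 * (jacobiSn k u * jacobiCn k u * jacobiDn k u) * jacobiSn (compModulus k) v ^ 2)
      u := by
  have hs := (hasDerivAt_jacobiSn hk0 hk1 u).ofReal_comp
  refine ((((hs.pow 2).mul_const _).const_mul _).const_add _).congr_deriv ?_
  push_cast
  ring

lemma hasDerivAt_snDen_right {k : ℝ} (hk0 : 0 < k) (hk1 : k < 1) (u v : ℝ) :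
    HasDerivAt (fun v => snDen k u v)
      (2 * (k ^ 2 * jacobiSn k u ^ 2 - 1) * (jacobiSn (compModulus k) v *
        jacobiCn (compModulus k) v * jacobiDn (compModulus k) v)) v := by
  have h0 := compModulus_pos hk0 hk1
  have h1 := compModulus_lt_one hk0 hk1
  have hs := (hasDerivAt_jacobiSn h0 h1 v).ofReal_comp
  have hc := (hasDerivAt_jacobiCn h0 h1 v).ofReal_comp
  refine ((hc.pow 2).add (((hs.pow 2).const_mul _).const_mul _)).congr_deriv ?_
  push_cast
  ring

lemma differentiable_ofReal_comp_re {f : ℝ → ℝ} (hf : Differentiable ℝ f) :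
    Differentiable ℝ (fun z : ℂ => (f z.re : ℂ)) :=
  Complex.ofRealCLM.differentiable.comp (hf.comp Complex.reCLM.differentiable)

lemma differentiable_ofReal_comp_im {f : ℝ → ℝ} (hf : Differentiable ℝ f) :
    Differentiable ℝ (fun z : ℂ => (f z.im : ℂ)) :=
  Complex.ofRealCLM.differentiable.comp (hf.comp Complex.imCLM.differentiable)

lemma differentiable_snNum {k : ℝ} (hk0 : 0 < k) (hk1 : k < 1) :
    Differentiable ℝ (fun z : ℂ => snNum k z.re z.im) := by
  have h0 := compModulus_pos hk0 hk1
  have h1 := compModulus_lt_one hk0 hk1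
  have a1 := differentiable_ofReal_comp_re fun u => (hasDerivAt_jacobiSn hk0 hk1 u).differentiableAt
  have a2 := differentiable_ofReal_comp_re fun u => (hasDerivAt_jacobiCn hk0 hk1 u).differentiableAt
  have a3 := differentiable_ofReal_comp_re fun u => (hasDerivAt_jacobiDn hk0 hk1 u).differentiableAt
  have b1 := differentiable_ofReal_comp_im fun u => (hasDerivAt_jacobiSn h0 h1 u).differentiableAt
  have b2 := differentiable_ofReal_comp_im fun u => (hasDerivAt_jacobiCn h0 h1 u).differentiableAt
  have b3 := differentiable_ofReal_comp_im fun u => (hasDerivAt_jacobiDn h0 h1 u).differentiableAt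
  exact (a1.mul b3).add (((a2.mul a3).mul (b1.mul b2)).const_mul Complex.I)

lemma differentiable_snDen {k : ℝ} (hk0 : 0 < k) (hk1 : k < 1) :
    Differentiable ℝ (fun z : ℂ => snDen k z.re z.im) := by
  have h0 := compModulus_pos hk0 hk1
  have h1 := compModulus_lt_one hk0 hk1
  have a1 := differentiable_ofReal_comp_re fun u => (hasDerivAt_jacobiSn hk0 hk1 u).differentiableAt
  have b1 := differentiable_ofReal_comp_im fun u => (hasDerivAt_jacobiSn h0 h1 u).differentiableAt
  have b2 := differentiable_ofReal_comp_im fun u => (hasDerivAt_jacobiCn h0 h1 u).differentiableAt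
  exact (b2.pow 2).add (((a1.pow 2).mul (b1.pow 2)).const_mul _)

/-- The Cauchy-Riemann equation for the quotient `snNum / snDen`, in terms of the algebraic
relations between the Jacobi functions. -/
lemma sn_cauchyRiemann {k k' s c d s₁ c₁ d₁ : ℂ} (hk' : k' ^ 2 = 1 - k ^ 2)
    (hc : c ^ 2 = 1 - s ^ 2) (hd : d ^ 2 = 1 - k ^ 2 * s ^ 2)
    (hc₁ : c₁ ^ 2 = 1 - s₁ ^ 2) (hd₁ : d₁ ^ 2 = 1 - k' ^ 2 * s₁ ^ 2) :
    (-(s * (k' ^ 2 * s₁ * c₁)) + Complex.I * (c * d * (d₁ * (c₁ ^ 2 - s₁ ^ 2)))) *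
        (c₁ ^ 2 + k ^ 2 * (s ^ 2 * s₁ ^ 2)) -
      (s * d₁ + Complex.I * (c * d * (s₁ * c₁))) *
        (2 * (k ^ 2 * s ^ 2 - 1) * (s₁ * c₁ * d₁)) =
    Complex.I * ((c * d * d₁ - Complex.I * (s * (d ^ 2 + k ^ 2 * c ^ 2) * (s₁ * c₁))) *
        (c₁ ^ 2 + k ^ 2 * (s ^ 2 * s₁ ^ 2)) -
      (s * d₁ + Complex.I * (c * d * (s₁ * c₁))) *
        (2 * k ^ 2 * (s * c * d) * s₁ ^ 2)) := by
  -- Here `hre` compares the terms of the identity without i, after removing the factor s s₁ c₁, and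
  -- `him` those with i, after removing c d d₁.
  have hre : -(k' ^ 2) * (c₁ ^ 2 + k ^ 2 * (s ^ 2 * s₁ ^ 2)) - d₁ ^ 2 * (2 * (k ^ 2 * s ^ 2 - 1)) =
      (d ^ 2 + k ^ 2 * c ^ 2) * (c₁ ^ 2 + k ^ 2 * (s ^ 2 * s₁ ^ 2)) +
        c ^ 2 * d ^ 2 * (2 * k ^ 2 * s₁ ^ 2) := by
    rw [hd₁, hc₁, hd, hc, hk']; ring
  have him : (c₁ ^ 2 - s₁ ^ 2) * (c₁ ^ 2 + k ^ 2 * (s ^ 2 * s₁ ^ 2)) -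
      2 * (k ^ 2 * s ^ 2 - 1) * (s₁ ^ 2 * c₁ ^ 2) =
      (c₁ ^ 2 + k ^ 2 * (s ^ 2 * s₁ ^ 2)) - 2 * k ^ 2 * s ^ 2 * s₁ ^ 2 := by
    rw [hc₁]; ring
  linear_combination s * s₁ * c₁ * hre + Complex.I * c * d * d₁ * him +
    (s * s₁ * c₁ * ((d ^ 2 + k ^ 2 * c ^ 2) * (c₁ ^ 2 + k ^ 2 * (s ^ 2 * s₁ ^ 2)) +
        c ^ 2 * d ^ 2 * (2 * k ^ 2 * s₁ ^ 2))) * Complex.I_sq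

lemma differentiableAt_complexSn {k : ℝ} (hk0 : 0 < k) (hk1 : k < 1) {z : ℂ}
    (hz : snDen k z.re z.im ≠ 0) : DifferentiableAt ℂ (complexSn k) z := by
  have h0 := compModulus_pos hk0 hk1
  have h1 := compModulus_lt_one hk0 hk1
  have d1 := (hasDerivAt_snNum_left hk0 hk1 z.re z.im).div
    (hasDerivAt_snDen_left hk0 hk1 z.re z.im) hz
  have d2 := (hasDerivAt_snNum_right hk0 hk1 z.re z.im).div
    (hasDerivAt_snDen_right hk0 hk1 z.re z.im) hz
  refine (hasDerivAt_of_partials_re_im (g := fun u v => snNum k u v / snDen k u v)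
    ?_ d1
    (d2.congr_deriv ?_)).differentiableAt
  · simp only [div_eq_mul_inv]
    exact (differentiable_snNum hk0 hk1 z).mul ((differentiable_snDen hk0 hk1 z).inv hz)
  -- The two derivatives have the same denominator, so only the numerators of the quotient rule have
  -- to be compared.
  rw [← mul_div_assoc]
  congr 1
  apply sn_cauchyRiemann
  · exact_mod_cast compModulus_sq hk0 hk1
  · exact_mod_cast jacobiCn_sq k z.re
  · exact_mod_cast jacobiDn_sq hk0 hk1 z.re
  · exact_mod_cast jacobiCn_sq (compModulus k) z.im
  · exact_mod_cast jacobiDn_sq h0 h1 z.im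

/-- The denominator is the sum of squares cn(v, k')² + (k sn(u, k) sn(v, k'))². In the closed
rectangle the first vanishes only for |v| = K', where sn(v, k') ≠ 0, and then the second vanishes
only for u = 0: the poles ±iK'. -/
lemma snDen_ne_zero {k : ℝ} (hk0 : 0 < k) (hk1 : k < 1) {z : ℂ} (hre : |z.re| ≤ ellipticK k)
    (him : |z.im| ≤ ellipticK' k) (hz : z.re = 0 → |z.im| ≠ ellipticK' k) :
    snDen k z.re z.im ≠ 0 := by
  have h0 := compModulus_pos hk0 hk1
  have h1 := compModulus_lt_one hk0 hk1
  have e : snDen k z.re z.im = ((jacobiCn (compModulus k) z.im ^ 2 +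
    (k * jacobiSn k z.re * jacobiSn (compModulus k) z.im) ^ 2 : ℝ) : ℂ) := by
    rw [snDen]; push_cast; ring
  rw [e, Complex.ofReal_ne_zero]
  rcases him.lt_or_eq with h | h
  · have := jacobiCn_pos h0 h1 h
    positivity
  · have hs := jacobiSn_ne_zero hk0 hk1 (fun h' => hz h' h) hre
    have hv : z.im ≠ 0 := fun h' => by
      have := ellipticK_pos h0 h1
      rw [h', abs_zero] at h
      exact this.ne h
    have hs' := jacobiSn_ne_zero h0 h1 hv him
    positivity

/-! ### Values of sn on the sides of the rectangle. -/

lemma jacobiDn_ellipticK' {k : ℝ} (hk0 : 0 < k) (hk1 : k < 1) :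
    jacobiDn (compModulus k) (ellipticK' k) = k := by
  rw [jacobiDn, ellipticK', jacobiSn_ellipticK (compModulus_pos hk0 hk1)
    (compModulus_lt_one hk0 hk1), compModulus_sq hk0 hk1]
  ring_nf
  exact Real.sqrt_sq hk0.le

lemma complexSn_ofReal {k : ℝ} (hk0 : 0 < k) (hk1 : k < 1) (t : ℝ) :
    complexSn k t = jacobiSn k t := by
  have h0 := compModulus_pos hk0 hk1
  have h1 := compModulus_lt_one hk0 hk1
  simp [complexSn, snNum, snDen, jacobiSn_zero h0 h1, jacobiCn_zero h0 h1, jacobiDn_zero h0 h1]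

lemma complexSn_add_ellipticK' {k : ℝ} (hk0 : 0 < k) (hk1 : k < 1) (t : ℝ) :
    k * complexSn k (t + ellipticK' k * Complex.I) = jacobiNs k t := by
  have h0 := compModulus_pos hk0 hk1
  have h1 := compModulus_lt_one hk0 hk1
  have e1 : jacobiSn (compModulus k) (ellipticK' k) = 1 := jacobiSn_ellipticK h0 h1
  have e2 : jacobiCn (compModulus k) (ellipticK' k) = 0 := jacobiCn_ellipticK h0 h1
  have hk : (k : ℂ) ≠ 0 := by exact_mod_cast hk0.ne'
  simp [complexSn, snNum, snDen, e1, e2, jacobiDn_ellipticK' hk0 hk1, jacobiNs]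
  -- Where sn t = 0 both sides are 0 by the convention for division by zero, so no condition on t is
  -- needed.
  by_cases hs : (jacobiSn k t : ℂ) = 0
  · simp [hs]
  · field_simp

/-- At u = K one has sn = 1 and cn = 0, so the numerator is dn(η, k') and the denominator cn² + k²
sn² = dn(η, k')². -/
lemma complexSn_ellipticK_add {k : ℝ} (hk0 : 0 < k) (hk1 : k < 1) (η : ℝ) :
    complexSn k (ellipticK k + η * Complex.I) = 1 / jacobiDn (compModulus k) η := by
  have h0 := compModulus_pos hk0 hk1
  have h1 := compModulus_lt_one hk0 hk1
  have e1 := jacobiDn_sq h0 h1 η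
  have e2 := jacobiCn_sq (compModulus k) η
  have e3 : (jacobiCn (compModulus k) η : ℂ) ^ 2 + k ^ 2 * jacobiSn (compModulus k) η ^ 2 =
      jacobiDn (compModulus k) η ^ 2 := by
    norm_cast
    rw [e1, e2, compModulus_sq hk0 hk1]; ring
  have hd : (jacobiDn (compModulus k) η : ℂ) ≠ 0 := by exact_mod_cast (jacobiDn_pos h0 h1 η).ne'
  simp [complexSn, snNum, snDen, jacobiSn_ellipticK hk0 hk1, jacobiCn_ellipticK hk0 hk1, e3]
  field_simp

lemma complexSn_neg_ellipticK_add {k : ℝ} (hk0 : 0 < k) (hk1 : k < 1) (η : ℝ) :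
    complexSn k (-ellipticK k + η * Complex.I) = -(1 / jacobiDn (compModulus k) η) := by
  rw [← complexSn_ellipticK_add hk0 hk1]
  simp [complexSn, snNum, snDen, jacobiSn_neg hk0 hk1, jacobiSn_ellipticK hk0 hk1,
    jacobiCn_neg hk0 hk1, jacobiCn_ellipticK hk0 hk1]
  ring

/-! ### The simple pole at iK'. -/

/-- The squared modulus of `snNum` factors as `snDen` times sn(u, k)² cn(v, k')² + sn(v, k')².
Multiplying numerator and denominator of 1/(k sn) by the conjugate of `snNum` therefore cancels
`snDen`, which vanishes at the pole, and leaves a factor that does not vanish there. -/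
lemma complexNsDiv_mul_complexSn {k : ℝ} (hk0 : 0 < k) (hk1 : k < 1) {z : ℂ}
    (hz : snDen k z.re z.im ≠ 0) (hs : jacobiSn (compModulus k) z.im ≠ 0) :
    complexNsDiv k z * (k * complexSn k z) = 1 := by
  have h0 := compModulus_pos hk0 hk1
  have h1 := compModulus_lt_one hk0 hk1
  have hk : (k : ℂ) ≠ 0 := by exact_mod_cast hk0.ne'
  have hM : ((jacobiSn k z.re ^ 2 * jacobiCn (compModulus k) z.im ^ 2 +
    jacobiSn (compModulus k) z.im ^ 2 : ℝ) : ℂ) ≠ 0 := by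
    norm_cast
    positivity
  have key : star (snNum k z.re z.im) * snNum k z.re z.im =
      snDen k z.re z.im * ((jacobiSn k z.re ^ 2 * jacobiCn (compModulus k) z.im ^ 2 +
        jacobiSn (compModulus k) z.im ^ 2 : ℝ) : ℂ) := by
    have a1 := jacobiCn_sq k z.re
    have a2 := jacobiDn_sq hk0 hk1 z.re
    have a3 := jacobiCn_sq (compModulus k) z.im
    have a4 := jacobiDn_sq h0 h1 z.im
    rw [compModulus_sq hk0 hk1] at a4
    have a5 : jacobiSn k z.re ^ 2 * jacobiDn (compModulus k) z.im ^ 2 +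
        jacobiCn k z.re ^ 2 * jacobiDn k z.re ^ 2 * (jacobiSn (compModulus k) z.im ^ 2 *
          jacobiCn (compModulus k) z.im ^ 2) =
        (jacobiCn (compModulus k) z.im ^ 2 +
          k ^ 2 * (jacobiSn k z.re ^ 2 * jacobiSn (compModulus k) z.im ^ 2)) *
        (jacobiSn k z.re ^ 2 * jacobiCn (compModulus k) z.im ^ 2 +
          jacobiSn (compModulus k) z.im ^ 2) := by
      rw [a1, a2, a3, a4]; ring
    have a6 := congrArg (fun r : ℝ => (r : ℂ)) a5
    push_cast at a6
    simp only [snNum, snDen, Complex.star_def, map_add, map_mul, Complex.conj_ofReal,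
      Complex.conj_I]
    push_cast
    linear_combination a6 - (jacobiCn k z.re ^ 2 * jacobiDn k z.re ^ 2 *
      (jacobiSn (compModulus k) z.im ^ 2 * jacobiCn (compModulus k) z.im ^ 2)) * Complex.I_sq
  rw [complexNsDiv, complexSn]
  field_simp
  rw [mul_comm, mul_comm] at key
  linear_combination key

/-- The derivative at this single point determines the residue; holomorphy of the reciprocal nearby
is not needed. -/
lemma hasDerivAt_complexNsDiv {k : ℝ} (hk0 : 0 < k) (hk1 : k < 1) :
    HasDerivAt (complexNsDiv k) 1 (Complex.I * ellipticK' k) := by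
  have h0 := compModulus_pos hk0 hk1
  have h1 := compModulus_lt_one hk0 hk1
  have hk : (k : ℂ) ≠ 0 := by exact_mod_cast hk0.ne'
  have e1 : jacobiSn (compModulus k) (ellipticK' k) = 1 := jacobiSn_ellipticK h0 h1
  have e2 : jacobiCn (compModulus k) (ellipticK' k) = 0 := jacobiCn_ellipticK h0 h1
  have e3 := jacobiDn_ellipticK' hk0 hk1
  have f1 := jacobiSn_zero hk0 hk1
  have f2 := jacobiCn_zero hk0 hk1
  have f3 := jacobiDn_zero hk0 hk1
  have hre : (Complex.I * ellipticK' k).re = 0 := by simp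
  have him : (Complex.I * ellipticK' k).im = ellipticK' k := by simp
  have s1 := fun u => (hasDerivAt_jacobiSn hk0 hk1 u)
  have t1 := fun u => (hasDerivAt_jacobiSn h0 h1 u)
  have t2 := fun u => (hasDerivAt_jacobiCn h0 h1 u)
  refine hasDerivAt_of_partials_re_im (g := fun u v => star (snNum k u v) / (k *
    ((jacobiSn k u ^ 2 * jacobiCn (compModulus k) v ^ 2 +
    jacobiSn (compModulus k) v ^ 2 : ℝ) : ℂ))) ?_ ?_ ?_
  · simp only [div_eq_mul_inv]
    refine (differentiable_snNum hk0 hk1 _).star.mul (.inv (.const_mul ?_ _) ?_)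
    · have a1 := differentiable_ofReal_comp_re fun u => (s1 u).differentiableAt
      have b1 := differentiable_ofReal_comp_im fun u => (t1 u).differentiableAt
      have b2 := differentiable_ofReal_comp_im fun u => (t2 u).differentiableAt
      push_cast
      exact (((a1.pow 2).mul (b2.pow 2)).add (b1.pow 2)) _
    · simp [hre, him, f1, e1, hk]
  · rw [hre, him]
    have hn := (hasDerivAt_snNum_left hk0 hk1 0 (ellipticK' k)).star
    have hm := ((((s1 0).pow 2).mul_const (jacobiCn (compModulus k) (ellipticK' k) ^ 2)).add_const
      (jacobiSn (compModulus k) (ellipticK' k) ^ 2)).ofReal_comp.const_mul (k : ℂ)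
    refine (hn.div hm ?_).congr_deriv ?_
    · simp [f1, e1, hk]
    · simp [snNum, e1, e2, e3, f1, f2, f3]
      field_simp
  · rw [hre, him]
    have hn := (hasDerivAt_snNum_right hk0 hk1 0 (ellipticK' k)).star
    have hm := ((((t2 (ellipticK' k)).pow 2).const_mul (jacobiSn k 0 ^ 2)).add
      ((t1 (ellipticK' k)).pow 2)).ofReal_comp.const_mul (k : ℂ)
    refine (hn.div hm ?_).congr_deriv ?_
    · simp [f1, e1, hk]
    · simp [snNum, e1, e2, e3, f1, f2, f3]
      field_simp

/-- `k sn(z, k)` has a simple pole with residue `1` at `z = i K'`. -/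
lemma tendsto_sub_mul_complexSn {k : ℝ} (hk0 : 0 < k) (hk1 : k < 1) :
    Tendsto (fun z : ℂ => (z - Complex.I * ellipticK' k) * (k * complexSn k z))
      (𝓝[{z : ℂ | z.im ≤ ellipticK' k} \ {Complex.I * ellipticK' k}] (Complex.I * ellipticK' k))
      (𝓝 1) := by
  have h0 := compModulus_pos hk0 hk1
  have h1 := compModulus_lt_one hk0 hk1
  have hK := ellipticK_pos hk0 hk1
  have hK' : 0 < ellipticK' k := ellipticK_pos h0 h1
  set p : ℂ := Complex.I * ellipticK' k with hp
  have hre : p.re = 0 := by simp [hp]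
  have him : p.im = ellipticK' k := by simp [hp]
  have hv : complexNsDiv k p = 0 := by
    have e2 : jacobiCn (compModulus k) (ellipticK' k) = 0 := jacobiCn_ellipticK h0 h1
    simp [complexNsDiv, snNum, hre, him, jacobiSn_zero hk0 hk1, e2]
  -- The reciprocal vanishes at p, so its slope there is 1/((z - p) k sn z); this tends to 1, hence
  -- so does the inverse.
  have hs := (hasDerivAt_iff_tendsto_slope.1 (hasDerivAt_complexNsDiv hk0 hk1)).inv₀ one_ne_zero
  rw [inv_one] at hs
  refine (hs.mono_left (nhdsWithin_mono _ fun z hz => hz.2)).congr' ?_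
  have n1 : ∀ᶠ z : ℂ in 𝓝 p, |z.re| < ellipticK k :=
    (continuous_abs.comp Complex.continuous_re).continuousAt.eventually_lt continuousAt_const
      (by simpa [hre] using hK)
  have n2 : ∀ᶠ z : ℂ in 𝓝 p, 0 < z.im :=
    continuousAt_const.eventually_lt Complex.continuous_im.continuousAt (by simpa [him] using hK')
  filter_upwards [self_mem_nhdsWithin, mem_nhdsWithin_of_mem_nhds n1,
    mem_nhdsWithin_of_mem_nhds n2] with z hz h1' h2'
  have hz1 : z.im ≤ ellipticK' k := hz.1
  have habs : |z.im| ≤ ellipticK' k := by rwa [abs_of_pos h2']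
  have hden : snDen k z.re z.im ≠ 0 := by
    refine snDen_ne_zero hk0 hk1 h1'.le habs fun hr hi => hz.2 ?_
    rw [abs_of_pos h2'] at hi
    exact Complex.ext (by rw [hr, hre]) (by rw [hi, him])
  have key := complexNsDiv_mul_complexSn hk0 hk1 hden (jacobiSn_ne_zero h0 h1 h2'.ne' habs)
  rw [slope_def_field, hv, sub_zero, inv_div, div_eq_mul_inv, eq_inv_of_mul_eq_one_right key]

/-! ### The half residue of a square indentation. -/

/-- Bottom side of the indentation rescaled to [-1, 1] × [-1, 0] with the pole at 0. In the
primitive log(1 + t²)/2 + i arctan t the even logarithm cancels between the endpoints. -/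
lemma integral_one_div_sub_I :
    ∫ t in (-1 : ℝ)..1, (1 : ℂ) / (t - Complex.I) = Complex.I * (π / 2) := by
  have h : ∀ t ∈ uIcc (-1 : ℝ) 1, HasDerivAt
      (fun t : ℝ => ((Real.log (1 + t ^ 2) / 2 : ℝ) : ℂ) + Complex.I * (Real.arctan t : ℝ))
      ((1 : ℂ) / (t - Complex.I)) t := by
    intro t _
    have hp : 1 + t ^ 2 ≠ 0 := by positivity
    have h1 := ((((hasDerivAt_id t).pow 2).const_add 1).log hp).div_const 2
    have h2 := (hasDerivAt_arctan t).ofReal_comp.const_mul Complex.I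
    refine (h1.ofReal_comp.add h2).congr_deriv ?_
    have hp' : (1 + (t : ℂ) ^ 2) ≠ 0 := by exact_mod_cast hp
    have hI : (t : ℂ) - Complex.I ≠ 0 := fun h => by simpa using congrArg Complex.im h
    simp
    field_simp
    linear_combination (-1 : ℂ) * Complex.I_sq
  rw [intervalIntegral.integral_eq_sub_of_hasDerivAt h]
  · simp
    ring
  · refine ContinuousOn.intervalIntegrable (continuousOn_const.div (by fun_prop) fun t _ h => ?_)
    simpa using congrArg Complex.im h

/-- The two vertical sides of the same rescaled square: the integrands differ by 2/(1 + s²). Times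
i, this supplies the other half of the total πi. -/
lemma integral_one_div_side :
    (∫ s in (-1 : ℝ)..0, (1 : ℂ) / (1 + s * Complex.I)) -
      ∫ s in (-1 : ℝ)..0, (1 : ℂ) / (-1 + s * Complex.I) = π / 2 := by
  have hne : ∀ s : ℝ, (1 : ℂ) + s * Complex.I ≠ 0 := fun s h => by
    simpa using congrArg Complex.re h
  have hne' : ∀ s : ℝ, (-1 : ℂ) + s * Complex.I ≠ 0 := fun s h => by
    simpa using congrArg Complex.re h
  rw [← intervalIntegral.integral_sub]
  · have h : ∀ s : ℝ, (1 : ℂ) / (1 + s * Complex.I) - 1 / (-1 + s * Complex.I) =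
        ((2 * (1 + s ^ 2)⁻¹ : ℝ) : ℂ) := by
      intro s
      have h1 := hne s
      have h2 := hne' s
      have hp' : (1 + (s : ℂ) ^ 2) ≠ 0 := by
        exact_mod_cast (by positivity : 1 + s ^ 2 ≠ 0)
      push_cast
      field_simp
      linear_combination (-2 * s ^ 2 : ℂ) * Complex.I_sq
    simp_rw [h]
    rw [intervalIntegral.integral_ofReal, intervalIntegral.integral_const_mul,
      integral_inv_one_add_sq]
    simp
    ring
  · exact (continuous_const.div (by fun_prop) hne).intervalIntegrable _ _
  · exact (continuous_const.div (by fun_prop) hne').intervalIntegrable _ _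

/-- The integral of `f` over three sides of the square `[-ε, ε] × [H - ε, H]`, counterclockwise
from `-ε + iH` to `ε + iH`. -/
noncomputable def indentIntegral (f : ℂ → ℂ) (H ε : ℝ) : ℂ :=
  (∫ t in (-ε)..ε, f (t + ((H - ε : ℝ) : ℂ) * Complex.I)) +
    Complex.I * (∫ η in (H - ε)..H, f (ε + η * Complex.I)) -
    Complex.I * ∫ η in (H - ε)..H, f (-ε + η * Complex.I)

/-- Rescaling z = iH + εγ makes the path γ independent of ε, as dominated convergence requires. -/
lemma indentIntegral_eq (f : ℂ → ℂ) (H ε : ℝ) :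
    indentIntegral f H ε =
      (∫ t in (-1 : ℝ)..1, ε * f (H * Complex.I + ε * (t - Complex.I))) +
      Complex.I * (∫ s in (-1 : ℝ)..0, ε * f (H * Complex.I + ε * (1 + s * Complex.I))) -
      Complex.I * ∫ s in (-1 : ℝ)..0, ε * f (H * Complex.I + ε * (-1 + s * Complex.I)) := by
  have h1 := intervalIntegral.smul_integral_comp_mul_add (a := -1) (b := 1)
    (fun t : ℝ => f (t + ((H - ε : ℝ) : ℂ) * Complex.I)) ε 0
  have h2 := intervalIntegral.smul_integral_comp_mul_add (a := -1) (b := 0)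
    (fun t : ℝ => f (ε + t * Complex.I)) ε H
  have h3 := intervalIntegral.smul_integral_comp_mul_add (a := -1) (b := 0)
    (fun t : ℝ => f (-ε + t * Complex.I)) ε H
  simp only [mul_neg, mul_one, add_zero, mul_zero, zero_add, neg_add_eq_sub ε H] at h1 h2 h3
  have e1 (t : ℝ) : ((ε * t : ℝ) : ℂ) + ((H - ε : ℝ) : ℂ) * Complex.I =
      H * Complex.I + ε * (t - Complex.I) := by push_cast; ring
  have e2 (t : ℝ) : (ε : ℂ) + ((ε * t + H : ℝ) : ℂ) * Complex.I =
      H * Complex.I + ε * (1 + t * Complex.I) := by push_cast; ring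
  have e3 (t : ℝ) : -(ε : ℂ) + ((ε * t + H : ℝ) : ℂ) * Complex.I =
      H * Complex.I + ε * (-1 + t * Complex.I) := by push_cast; ring
  rw [indentIntegral, ← h1, ← h2, ← h3]
  simp only [intervalIntegral.integral_const_mul, Complex.real_smul, e1, e2, e3]

/-- The half residue at the top of an indentation. -/
lemma tendsto_indentIntegral {f : ℂ → ℂ} {H : ℝ} {c : ℂ}
    (hf : Tendsto (fun z : ℂ => (z - Complex.I * H) * f z)
      (𝓝[{z : ℂ | z.im ≤ H} \ {Complex.I * H}] (Complex.I * H)) (𝓝 c))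
    (hcont : ∃ a > 0, ContinuousOn f ((Icc (-a) a ×ℂ Icc (H - a) H) \ {Complex.I * H})) :
    Tendsto (indentIntegral f H) (𝓝[>] 0) (𝓝 (π * Complex.I * c)) := by
  obtain ⟨a, ha, hcont⟩ := hcont
  -- On each side ε f(iH + εγ) = (z - iH) f(z) / γ with z = iH + εγ. The numerator tends to c and is
  -- bounded near the pole, while 1/γ is integrable because γ avoids 0.
  have side : ∀ (l r : ℝ) (γ : ℝ → ℂ), l ≤ r → Continuous γ →
      (∀ t ∈ Icc l r, γ t ≠ 0 ∧ (γ t).re ∈ Icc (-1) 1 ∧ (γ t).im ∈ Icc (-1) 0) →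
      Tendsto (fun ε : ℝ => ∫ t in l..r, ε * f (H * Complex.I + ε * γ t)) (𝓝[>] 0)
        (𝓝 (c * ∫ t in l..r, 1 / γ t)) := by
    intro l r γ hlr hγ hγ'
    rw [← intervalIntegral.integral_const_mul]
    have hI : uIoc l r ⊆ Icc l r := by rw [uIoc_of_le hlr]; exact Ioc_subset_Icc_self
    have hmem : ∀ ε : ℝ, 0 < ε → ∀ t ∈ Icc l r, H * Complex.I + ε * γ t ∈
        {z : ℂ | z.im ≤ H} \ {Complex.I * H} := by
      intro ε hε t ht
      obtain ⟨g0, -, g2⟩ := hγ' t ht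
      refine ⟨by simpa using mul_nonpos_of_nonneg_of_nonpos hε.le g2.2, fun h => ?_⟩
      rw [mem_singleton_iff, mul_comm Complex.I, add_eq_left] at h
      exact (mul_ne_zero (by exact_mod_cast hε.ne') g0) h
    have hfac : ∀ ε : ℝ, ∀ t ∈ Icc l r, ε * f (H * Complex.I + ε * γ t) =
        (H * Complex.I + ε * γ t - Complex.I * H) * f (H * Complex.I + ε * γ t) / γ t := by
      intro ε t ht
      have := (hγ' t ht).1
      field_simp
      ring
    have hb : ∀ᶠ z in 𝓝[{z : ℂ | z.im ≤ H} \ {Complex.I * H}] (Complex.I * H),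
        ‖(z - Complex.I * H) * f z‖ ≤ ‖c‖ + 1 :=
      (hf.norm.eventually_lt_const (lt_add_one ‖c‖)).mono fun z hz => hz.le
    obtain ⟨δ, hδ, hδb⟩ := Metric.mem_nhdsWithin_iff.1 hb
    refine intervalIntegral.tendsto_integral_filter_of_dominated_convergence
      (fun t => (‖c‖ + 1) / ‖γ t‖) ?_ ?_ ?_ ?_
    · filter_upwards [Ioo_mem_nhdsGT ha] with ε hε
      refine (ContinuousOn.mono ?_ hI).aestronglyMeasurable measurableSet_uIoc
      refine continuousOn_const.mul (hcont.comp (by fun_prop) fun t ht => ?_)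
      obtain ⟨g0, g1, g2⟩ := hγ' t ht
      refine ⟨⟨?_, ?_⟩, (hmem ε hε.1 t ht).2⟩
      · simp only [mem_preimage, Complex.add_re, Complex.mul_re, Complex.ofReal_re, Complex.I_re,
          Complex.ofReal_im, Complex.I_im, mem_Icc]
        constructor <;> nlinarith [g1.1, g1.2, hε.1, hε.2]
      · simp only [mem_preimage, Complex.add_im, Complex.mul_im, Complex.ofReal_re, Complex.I_re,
          Complex.ofReal_im, Complex.I_im, mem_Icc]
        constructor <;> nlinarith [g2.1, g2.2, hε.1, hε.2]
    -- Since ‖γ‖ ≤ 2 on the square, ε < δ/2 keeps z within δ of the pole, where the bound holds.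
    · filter_upwards [Ioo_mem_nhdsGT (half_pos hδ)] with ε hε
      refine Eventually.of_forall fun t ht => ?_
      have ht := hI ht
      obtain ⟨g0, g1, g2⟩ := hγ' t ht
      rw [hfac ε t ht, norm_div]
      gcongr
      refine hδb ⟨?_, hmem ε hε.1 t ht⟩
      have h2 : ‖γ t‖ ≤ 2 := by
        have := Complex.norm_le_abs_re_add_abs_im (γ t)
        have e1 := abs_le.2 g1
        have e2 : |(γ t).im| ≤ 1 := abs_le.2 ⟨g2.1, by linarith [g2.2]⟩
        linarith
      rw [Metric.mem_ball, dist_eq_norm, mul_comm Complex.I, add_sub_cancel_left, norm_mul,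
        Complex.norm_real, Real.norm_of_nonneg hε.1.le]
      nlinarith [hε.1, hε.2]
    · refine ContinuousOn.intervalIntegrable (continuousOn_const.div hγ.norm.continuousOn ?_)
      intro t ht
      rw [uIcc_of_le hlr] at ht
      exact norm_ne_zero_iff.2 (hγ' t ht).1
    · refine Eventually.of_forall fun t ht => ?_
      have ht := hI ht
      have lim : Tendsto (fun ε : ℝ => H * Complex.I + ε * γ t) (𝓝[>] 0)
          (𝓝[{z : ℂ | z.im ≤ H} \ {Complex.I * H}] (Complex.I * H)) := by
        refine tendsto_nhdsWithin_iff.2 ⟨?_, ?_⟩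
        · have : Continuous fun ε : ℝ => H * Complex.I + ε * γ t := by fun_prop
          simpa [mul_comm] using (this.tendsto 0).mono_left nhdsWithin_le_nhds
        · filter_upwards [self_mem_nhdsWithin] with ε hε using hmem ε hε t ht
      rw [mul_one_div]
      exact ((hf.comp lim).div_const _).congr fun ε => (hfac ε t ht).symm
  have s1 := side (-1) 1 (fun t => t - Complex.I) (by norm_num) (by fun_prop) (by
    intro t ht
    refine ⟨fun h => by simpa using congrArg Complex.im h, by simpa using ht, by simp⟩)
  have s2 := side (-1) 0 (fun t => 1 + t * Complex.I) (by norm_num) (by fun_prop) (by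
    intro t ht
    refine ⟨fun h => by simpa using congrArg Complex.re h, by simp, by simpa using ht⟩)
  have s3 := side (-1) 0 (fun t => -1 + t * Complex.I) (by norm_num) (by fun_prop) (by
    intro t ht
    refine ⟨fun h => by simpa using congrArg Complex.re h, by simp, by simpa using ht⟩)
  have key := (s1.add (s2.const_mul Complex.I)).sub (s3.const_mul Complex.I)
  have hval : c * (∫ t in (-1 : ℝ)..1, (1 : ℂ) / (t - Complex.I)) +
      Complex.I * (c * ∫ t in (-1 : ℝ)..0, (1 : ℂ) / (1 + t * Complex.I)) -
      Complex.I * (c * ∫ t in (-1 : ℝ)..0, (1 : ℂ) / (-1 + t * Complex.I)) =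
      π * Complex.I * c := by
    rw [integral_one_div_sub_I]
    linear_combination Complex.I * c * integral_one_div_side
  rw [hval] at key
  exact key.congr fun ε => (indentIntegral_eq f H ε).symm

/-! ### Cauchy's theorem on the indented rectangle. -/

/-- The indented rectangle is the union of a slab below height H - ε and two blocks beside the
square. Each closed piece avoids iH, so Cauchy's theorem for rectangles applies to it with mere
continuity up to the boundary. -/
lemma integral_indented_rect {f : ℂ → ℂ} {a H ε : ℝ} (hε : 0 < ε) (hεa : ε < a) (hεH : ε < H)
    (hc : ContinuousOn f ((Icc (-a) a ×ℂ Icc 0 H) \ {Complex.I * H}))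
    (hd : ∀ z ∈ Ioo (-a) a ×ℂ Ioo 0 H, DifferentiableAt ℂ f z) :
    (∫ t in (-a)..a, f t) + Complex.I * (∫ η in (0 : ℝ)..H, f (a + η * Complex.I)) -
      Complex.I * (∫ η in (0 : ℝ)..H, f (-a + η * Complex.I)) -
      ((∫ t in (-a)..(-ε), f (t + H * Complex.I)) + ∫ t in ε..a, f (t + H * Complex.I)) =
    indentIntegral f H ε := by
  have rect : ∀ a₁ a₂ b₁ b₂ : ℝ, -a ≤ a₁ → a₁ ≤ a₂ → a₂ ≤ a → 0 ≤ b₁ → b₁ ≤ b₂ → b₂ ≤ H →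
      (0 < a₁ ∨ a₂ < 0 ∨ b₂ < H) →
      (∫ t in a₁..a₂, f (t + b₁ * Complex.I)) - (∫ t in a₁..a₂, f (t + b₂ * Complex.I)) +
      Complex.I * (∫ η in b₁..b₂, f (a₂ + η * Complex.I)) -
      Complex.I * (∫ η in b₁..b₂, f (a₁ + η * Complex.I)) = 0 := by
    intro a₁ a₂ b₁ b₂ h1 h2 h3 h4 h5 h6 h7
    have := Complex.integral_boundary_rect_eq_zero_of_continuousOn_of_differentiableOn f
      ⟨a₁, b₁⟩ ⟨a₂, b₂⟩ (hc.mono ?_) ?_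
    · simpa using this
    · simp only [uIcc_of_le h2, uIcc_of_le h5]
      rintro z ⟨hz1, hz2⟩
      simp only [mem_preimage, mem_Icc] at hz1 hz2
      refine ⟨⟨⟨by linarith, by linarith⟩, ⟨by linarith, by linarith⟩⟩, ?_⟩
      rintro rfl
      simp at hz1 hz2
      rcases h7 with h | h | h <;> linarith
    · simp only [min_eq_left h2, min_eq_left h5, max_eq_right h2, max_eq_right h5]
      rintro z ⟨hz1, hz2⟩
      simp only [mem_preimage, mem_Ioo] at hz1 hz2
      exact (hd z ⟨⟨by linarith, by linarith⟩, ⟨by linarith, by linarith⟩⟩).differentiableWithinAt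
  have r1 := rect (-a) a 0 (H - ε) le_rfl (by linarith) le_rfl le_rfl (by linarith) (by linarith)
    (.inr (.inr (by linarith)))
  have r2 := rect (-a) (-ε) (H - ε) H le_rfl (by linarith) (by linarith) (by linarith)
    (by linarith) le_rfl (.inr (.inl (by linarith)))
  have r3 := rect ε a (H - ε) H (by linarith) (by linarith) le_rfl (by linarith)
    (by linarith) le_rfl (.inl hε)
  have hor : ∀ a₁ a₂ : ℝ, -a ≤ a₁ → a₁ ≤ a₂ → a₂ ≤ a →
      IntervalIntegrable (fun t : ℝ => f (t + ((H - ε : ℝ) : ℂ) * Complex.I)) volume a₁ a₂ := by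
    intro a₁ a₂ h1 h2 h3
    refine ContinuousOn.intervalIntegrable (hc.comp (by fun_prop) fun t ht => ?_)
    rw [uIcc_of_le h2] at ht
    refine ⟨⟨by simpa using ⟨by linarith [ht.1], by linarith [ht.2]⟩,
      by simp; constructor <;> linarith⟩, fun h => ?_⟩
    have := congrArg Complex.im h
    simp at this
    linarith
  have ver : ∀ b b₁ b₂ : ℝ, |b| = a → 0 ≤ b₁ → b₁ ≤ b₂ → b₂ ≤ H →
      IntervalIntegrable (fun η : ℝ => f (b + η * Complex.I)) volume b₁ b₂ := by
    intro b b₁ b₂ h h1 h2 h3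
    refine ContinuousOn.intervalIntegrable (hc.comp (by fun_prop) fun t ht => ?_)
    rw [uIcc_of_le h2] at ht
    refine ⟨⟨by simpa using abs_le.1 h.le, by simpa using ⟨by linarith [ht.1], by linarith [ht.2]⟩⟩,
      fun h' => ?_⟩
    have := congrArg Complex.re h'
    simp at this
    rw [this, abs_zero] at h
    linarith
  have q1 := intervalIntegral.integral_add_adjacent_intervals
    (hor (-a) (-ε) le_rfl (by linarith) (by linarith)) (hor (-ε) ε (by linarith) (by linarith) hεa.le)
  have q2 := intervalIntegral.integral_add_adjacent_intervals
    (hor (-a) ε le_rfl (by linarith) hεa.le) (hor ε a (by linarith) hεa.le le_rfl)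
  have hav : |a| = a := abs_of_pos (by linarith)
  have hav' : |-a| = a := by rw [abs_neg, hav]
  have q3 := intervalIntegral.integral_add_adjacent_intervals
    (ver a 0 (H - ε) hav le_rfl (by linarith) (by linarith))
    (ver a (H - ε) H hav (by linarith) (by linarith) le_rfl)
  have q4 := intervalIntegral.integral_add_adjacent_intervals
    (ver (-a) 0 (H - ε) hav' le_rfl (by linarith) (by linarith))
    (ver (-a) (H - ε) H hav' (by linarith) (by linarith) le_rfl)
  rw [indentIntegral]
  simp only [Complex.ofReal_zero, zero_mul, add_zero, Complex.ofReal_neg] at *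
  -- The segments shared by the slab and the blocks cancel; the uncancelled middle segment and the
  -- inner vertical sides form the indentation.
  linear_combination r1 + r2 + r3 - q1 - q2 - Complex.I * q3 + Complex.I * q4

/-! ### The integrand k sn(z) U(x + z) on the rectangle. -/

lemma closure_ellipticStrip {k : ℝ} (hk0 : 0 < k) (hk1 : k < 1) :
    closure (ellipticStrip k) = {z : ℂ | -ellipticK' k ≤ z.im ∧ z.im ≤ ellipticK' k} := by
  have h := ellipticK_pos (compModulus_pos hk0 hk1) (compModulus_lt_one hk0 hk1)
  change closure (Complex.im ⁻¹' Ioo (-ellipticK' k) (ellipticK' k)) = _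
  rw [Complex.closure_preimage_im, closure_Ioo (by unfold ellipticK'; linarith)]
  rfl

lemma isOpen_ellipticStrip (k : ℝ) : IsOpen (ellipticStrip k) :=
  isOpen_Ioo.preimage Complex.continuous_im

lemma continuous_jacobiSn {k : ℝ} (hk0 : 0 < k) (hk1 : k < 1) : Continuous (jacobiSn k) :=
  continuous_sin.comp (continuous_jacobiAm hk0 hk1)

lemma jacobiNs_neg {k : ℝ} (hk0 : 0 < k) (hk1 : k < 1) (u : ℝ) :
    jacobiNs k (-u) = -jacobiNs k u := by
  rw [jacobiNs, jacobiSn_neg hk0 hk1, inv_neg, jacobiNs]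

/-- The integrand `k sn(z, k) U(x + z)` of the contour integral. -/
noncomputable def stripIntegrand (k : ℝ) (U : ℂ → ℂ) (x : ℝ) (z : ℂ) : ℂ :=
  k * complexSn k z * U (x + z)

lemma continuousOn_stripIntegrand {k : ℝ} (hk0 : 0 < k) (hk1 : k < 1) {U : ℂ → ℂ}
    (hU : ContinuousOn U (closure (ellipticStrip k))) (x : ℝ) :
    ContinuousOn (stripIntegrand k U x)
      ((Icc (-ellipticK k) (ellipticK k) ×ℂ Icc 0 (ellipticK' k)) \
        {Complex.I * ellipticK' k}) := by
  rw [closure_ellipticStrip hk0 hk1] at hU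
  refine (continuousOn_const.mul fun z hz => ?_).mul (hU.comp (by fun_prop) fun z hz => ?_)
  · obtain ⟨⟨h1, h2⟩, h3⟩ := hz
    have habs : |z.im| = z.im := abs_of_nonneg h2.1
    refine (differentiableAt_complexSn hk0 hk1 (snDen_ne_zero hk0 hk1 (abs_le.2 h1)
      (by rw [habs]; exact h2.2) fun hr hi => h3 ?_)).continuousAt.continuousWithinAt
    rw [habs] at hi
    exact Complex.ext (by simp [hr]) (by simp [hi])
  · obtain ⟨⟨h1, h2⟩, h3⟩ := hz
    simp only [mem_preimage, mem_Icc] at h2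
    simp only [mem_ofPred_eq, Complex.add_im, Complex.ofReal_im, zero_add]
    constructor <;> linarith

lemma differentiableAt_stripIntegrand {k : ℝ} (hk0 : 0 < k) (hk1 : k < 1) {U : ℂ → ℂ}
    (hU : DifferentiableOn ℂ U (ellipticStrip k)) (x : ℝ) {z : ℂ}
    (hz : z ∈ Ioo (-ellipticK k) (ellipticK k) ×ℂ Ioo 0 (ellipticK' k)) :
    DifferentiableAt ℂ (stripIntegrand k U x) z := by
  obtain ⟨h1, h2⟩ := hz
  simp only [mem_preimage, mem_Ioo] at h1 h2
  have habs : |z.im| = z.im := abs_of_pos h2.1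
  refine ((differentiableAt_complexSn hk0 hk1 (snDen_ne_zero hk0 hk1 (abs_le.2 ⟨h1.1.le, h1.2.le⟩)
    (by rw [habs]; exact h2.2.le) fun _ hi => ?_)).const_mul _).mul ?_
  · rw [habs] at hi
    exact h2.2.ne hi
  · have hm : (x : ℂ) + z ∈ ellipticStrip k := by
      change _ < (x + z).im ∧ (x + z).im < _
      simp only [Complex.add_im, Complex.ofReal_im, zero_add]
      constructor <;> linarith
    exact (hU.differentiableAt ((isOpen_ellipticStrip k).mem_nhds hm)).comp z
      (differentiableAt_id.const_add _)

/-- Residue 1 of k sn times continuity of U at x + iK'. The approach from Im z ≤ K' keeps x + z in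
the closed strip near the pole. -/
lemma tendsto_stripIntegrand {k : ℝ} (hk0 : 0 < k) (hk1 : k < 1) {U : ℂ → ℂ}
    (hU : ContinuousOn U (closure (ellipticStrip k))) (x : ℝ) :
    Tendsto (fun z : ℂ => (z - Complex.I * ellipticK' k) * stripIntegrand k U x z)
      (𝓝[{z : ℂ | z.im ≤ ellipticK' k} \ {Complex.I * ellipticK' k}] (Complex.I * ellipticK' k))
      (𝓝 (U (x + Complex.I * ellipticK' k))) := by
  have h0 := compModulus_pos hk0 hk1
  have h1 := compModulus_lt_one hk0 hk1
  have hK' : 0 < ellipticK' k := ellipticK_pos h0 h1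
  rw [closure_ellipticStrip hk0 hk1] at hU
  have hc := hU (x + Complex.I * ellipticK' k) (by simp [hK'.le])
  have hc' : Tendsto (fun z : ℂ => U (x + z))
      (𝓝[{z : ℂ | z.im ≤ ellipticK' k} \ {Complex.I * ellipticK' k}] (Complex.I * ellipticK' k))
      (𝓝 (U (x + Complex.I * ellipticK' k))) := by
    refine hc.tendsto.comp (tendsto_nhdsWithin_iff.2 ⟨?_, ?_⟩)
    · have : Continuous fun z : ℂ => (x : ℂ) + z := by fun_prop
      exact (this.tendsto _).mono_left nhdsWithin_le_nhds
    · have n2 : ∀ᶠ z : ℂ in 𝓝 (Complex.I * ellipticK' k), -ellipticK' k < z.im :=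
        continuousAt_const.eventually_lt Complex.continuous_im.continuousAt (by simp [hK'])
      filter_upwards [self_mem_nhdsWithin, mem_nhdsWithin_of_mem_nhds n2] with z hz hz'
      exact ⟨by simpa using hz'.le, by simpa using hz.1⟩
  have := (tendsto_sub_mul_complexSn hk0 hk1).mul hc'
  rw [one_mul] at this
  refine this.congr fun z => ?_
  rw [stripIntegrand]
  ring

lemma stripIntegrand_top {k : ℝ} (hk0 : 0 < k) (hk1 : k < 1) (U : ℂ → ℂ) (x t : ℝ) :
    stripIntegrand k U x (t + ellipticK' k * Complex.I) =
      jacobiNs k t * U ((x + t : ℝ) + Complex.I * ellipticK' k) := by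
  rw [stripIntegrand, complexSn_add_ellipticK' hk0 hk1]
  push_cast
  ring_nf

/-- A real point is its own conjugate, so the symmetry forces U to be real on ℝ; sn is real there
too. -/
lemma im_stripIntegrand_ofReal {k : ℝ} (hk0 : 0 < k) (hk1 : k < 1) {U : ℂ → ℂ}
    (hsymm : ∀ z ∈ ellipticStrip k, U (star z) = star (U z)) (x t : ℝ) :
    (stripIntegrand k U x t).im = 0 := by
  have hK' : 0 < ellipticK' k := ellipticK_pos (compModulus_pos hk0 hk1) (compModulus_lt_one hk0 hk1)
  have h := hsymm ((x + t : ℝ) : ℂ) ⟨by simpa using hK', by simpa using hK'⟩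
  rw [Complex.star_def, Complex.conj_ofReal, eq_comm,
    Complex.conj_eq_iff_im] at h
  push_cast at h
  rw [stripIntegrand, complexSn_ofReal hk0 hk1]
  simp [h]

lemma continuousOn_correctionIntegrand {k : ℝ} (hk0 : 0 < k) (hk1 : k < 1) {U : ℂ → ℂ}
    (hU : ContinuousOn U (closure (ellipticStrip k))) (x : ℝ) :
    ContinuousOn (correctionIntegrand k U x) (Icc 0 (ellipticK' k)) := by
  have h0 := compModulus_pos hk0 hk1
  have h1 := compModulus_lt_one hk0 hk1
  rw [closure_ellipticStrip hk0 hk1] at hU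
  refine ContinuousOn.mul ?_ (Complex.continuous_re.comp_continuousOn (.add ?_ ?_))
  · refine (continuous_const.div ?_ fun η => (jacobiDn_pos h0 h1 η).ne').continuousOn
    exact continuous_iff_continuousAt.2 fun η => (hasDerivAt_jacobiDn h0 h1 η).continuousAt
  · refine hU.comp (by fun_prop) fun η hη => ?_
    have := hη.1
    have := hη.2
    simp
    constructor <;> linarith
  · refine hU.comp (by fun_prop) fun η hη => ?_
    have := hη.1
    have := hη.2
    simp
    constructor <;> linarith

/-- The vertical sides of the contour contribute `π C(x)`. -/
lemma im_sides_stripIntegrand {k : ℝ} (hk0 : 0 < k) (hk1 : k < 1) {U : ℂ → ℂ}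
    (hU : ContinuousOn U (closure (ellipticStrip k))) (x : ℝ) :
    (Complex.I * (∫ η in (0 : ℝ)..ellipticK' k,
        stripIntegrand k U x (ellipticK k + η * Complex.I)) -
      Complex.I * ∫ η in (0 : ℝ)..ellipticK' k,
        stripIntegrand k U x (-ellipticK k + η * Complex.I)).im = π * correction k U x := by
  have hK := ellipticK_pos hk0 hk1
  have hK' : 0 < ellipticK' k := ellipticK_pos (compModulus_pos hk0 hk1) (compModulus_lt_one hk0 hk1)
  have hc := continuousOn_stripIntegrand hk0 hk1 hU x
  have ver : ∀ b : ℝ, |b| = ellipticK k → IntervalIntegrable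
      (fun η : ℝ => stripIntegrand k U x (b + η * Complex.I)) volume 0 (ellipticK' k) := by
    intro b h
    refine ContinuousOn.intervalIntegrable (hc.comp (by fun_prop) fun t ht => ?_)
    rw [uIcc_of_le hK'.le] at ht
    refine ⟨⟨by simpa using abs_le.1 h.le, by simpa using ht⟩, fun h' => ?_⟩
    have := congrArg Complex.re h'
    simp at this
    rw [this, abs_zero] at h
    linarith
  have v1 := ver _ (abs_of_pos hK)
  have v2 := ver (-ellipticK k) (by rw [abs_neg, abs_of_pos hK])
  rw [Complex.ofReal_neg] at v2
  rw [← mul_sub, ← intervalIntegral.integral_sub v1 v2, Complex.I_mul_im, correction,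
    ← mul_assoc, mul_div_cancel₀ _ pi_ne_zero, ← intervalIntegral.integral_const_mul]
  have := Complex.reCLM.intervalIntegral_comp_comm (v1.sub v2)
  simp only [Complex.reCLM_apply] at this
  rw [← this]
  refine intervalIntegral.integral_congr fun η _ => ?_
  simp only [stripIntegrand, complexSn_ellipticK_add hk0 hk1, complexSn_neg_ellipticK_add hk0 hk1,
    correctionIntegrand]
  -- The opposite signs of sn at K and -K compensate the opposite orientations of the two sides,
  -- which is why C(x) contains a sum.
  have e : (k : ℂ) * (1 / jacobiDn (compModulus k) η) * U (x + (ellipticK k + η * Complex.I)) -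
      k * (-(1 / jacobiDn (compModulus k) η)) * U (x + (-ellipticK k + η * Complex.I)) =
      ((k * (1 / jacobiDn (compModulus k) η) : ℝ) : ℂ) *
      (U (x + ellipticK k + Complex.I * η) + U (x - ellipticK k + Complex.I * η)) := by
    push_cast
    rw [← add_assoc, ← add_assoc, mul_comm (η : ℂ), ← sub_eq_add_neg]
    ring
  rw [e, Complex.re_ofReal_mul, mul_assoc]

/-! ### The boundary formula and the antiperiodic case. -/

theorem mainTheorem5 (k : ℝ) (hk0 : 0 < k) (hk1 : k < 1) (U : ℂ → ℂ)
    (hU : DiffContOnCl ℂ U (ellipticStrip k))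
    (hHolder : HolderOnBoundedParts U (frontier (ellipticStrip k)))
    (hsymm : ∀ z ∈ ellipticStrip k, U (star z) = star (U z))
    (w v : ℝ → ℝ)
    (hwv : ∀ x : ℝ, U (x + Complex.I * ellipticK' k) = w x + Complex.I * v x) :
    (∀ x : ℝ,
      IntervalIntegrable (correctionIntegrand k U x) volume 0 (ellipticK' k) ∧
      ∃ P : ℝ,
        HasPrincipalValue (fun y => jacobiNs k (x - y) * v y)
          (x - ellipticK k) (x + ellipticK k) x P ∧
        w x = 1 / π * P + correction k U x) ∧
    ((∀ z ∈ ellipticStrip k, U (z + 2 * ellipticK k) = -U z) →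
      ∀ x : ℝ, correction k U x = 0) := by
  have hK := ellipticK_pos hk0 hk1
  have hK' : 0 < ellipticK' k := ellipticK_pos (compModulus_pos hk0 hk1) (compModulus_lt_one hk0 hk1)
  have hUc := hU.continuousOn
  have hUd := hU.differentiableOn
  -- The value of the principal value is the one forced by the formula; the content lies in the
  -- limit.
  refine ⟨fun x => ⟨?_, π * w x - π * correction k U x, ⟨?_, ?_⟩, ?_⟩, fun hper x => ?_⟩
  · refine ContinuousOn.intervalIntegrable ?_
    rw [uIcc_of_le hK'.le]
    exact continuousOn_correctionIntegrand hk0 hk1 hUc x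
  · have hv : Continuous v := by
      have e : v = fun y : ℝ => (U (y + Complex.I * ellipticK' k)).im := by
        funext y; rw [hwv]; simp
      rw [e]
      refine Complex.continuous_im.comp (hUc.comp_continuous (by fun_prop) fun y => ?_)
      rw [closure_ellipticStrip hk0 hk1]
      simp [hK'.le]
    have hint : ∀ a b : ℝ, x - ellipticK k ≤ a → a ≤ b → b ≤ x + ellipticK k → (x < a ∨ b < x) →
        IntervalIntegrable (fun y => jacobiNs k (x - y) * v y) volume a b := by
      intro a b h1 h2 h3 h4
      refine ContinuousOn.intervalIntegrable (.mul (.inv₀ ?_ fun y hy => ?_) hv.continuousOn)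
      · exact ((continuous_jacobiSn hk0 hk1).comp (by fun_prop)).continuousOn
      · rw [uIcc_of_le h2] at hy
        refine jacobiSn_ne_zero hk0 hk1 (fun h => ?_)
          (abs_le.2 ⟨by linarith [hy.1, hy.2], by linarith [hy.1, hy.2]⟩)
        rcases h4 with h4 | h4 <;> linarith [hy.1, hy.2]
    filter_upwards [Ioo_mem_nhdsGT hK] with ε hε
    have := hε.1
    have := hε.2
    exact ⟨hint _ _ le_rfl (by linarith) (by linarith) (.inr (by linarith)),
      hint _ _ (by linarith) (by linarith) le_rfl (.inl (by linarith))⟩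
  · have hcont := continuousOn_stripIntegrand hk0 hk1 hUc x
    have hJ := tendsto_indentIntegral (tendsto_stripIntegrand hk0 hk1 hUc x)
      ⟨min (ellipticK k) (ellipticK' k), lt_min hK hK', hcont.mono (sdiff_subset_sdiff_left
        (inter_subset_inter
        (preimage_mono (Icc_subset_Icc (neg_le_neg (min_le_left _ _)) (min_le_left _ _)))
        (preimage_mono (Icc_subset_Icc (by linarith [min_le_right (ellipticK k) (ellipticK' k)])
          le_rfl))))⟩
    have hlim := ((Complex.continuous_im.tendsto _).comp hJ).sub_const (π * correction k U x)
    have hval : (π * Complex.I * U (x + Complex.I * ellipticK' k)).im = π * w x := by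
      rw [hwv]; simp
    rw [hval] at hlim
    -- For small ε the truncated integral equals the imaginary part of the indentation integral
    -- minus πC(x), exactly.
    refine hlim.congr' ?_
    filter_upwards [Ioo_mem_nhdsGT (lt_min hK hK')] with ε hε
    have hε0 := hε.1
    have hε1 := hε.2.trans_le (min_le_left _ _)
    have hε2 := hε.2.trans_le (min_le_right _ _)
    have hrect := congrArg Complex.im (integral_indented_rect hε0 hε1 hε2 hcont
      fun z hz => differentiableAt_stripIntegrand hk0 hk1 hUd x hz)
    -- Substitution y = x + t; the minus sign comes from ns being odd.
    have him : ∀ (a b : ℝ), -ellipticK k ≤ a → a ≤ b → b ≤ ellipticK k → (0 < a ∨ b < 0) →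
        (∫ t in a..b, stripIntegrand k U x (t + ellipticK' k * Complex.I)).im =
          -∫ y in (x + a)..(x + b), jacobiNs k (x - y) * v y := by
      intro a b h1 h2 h3 h4
      have hi : IntervalIntegrable
          (fun t : ℝ => stripIntegrand k U x (t + ellipticK' k * Complex.I)) volume a b := by
        refine ContinuousOn.intervalIntegrable (hcont.comp (by fun_prop) fun t ht => ?_)
        rw [uIcc_of_le h2] at ht
        refine ⟨⟨by simpa using ⟨by linarith [ht.1], by linarith [ht.2]⟩, by simpa using hK'.le⟩,
          fun h => ?_⟩
        have := congrArg Complex.re h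
        simp at this
        rcases h4 with h4 | h4 <;> linarith [ht.1, ht.2]
      have := Complex.imCLM.intervalIntegral_comp_comm hi
      simp only [Complex.imCLM_apply] at this
      rw [← this, ← intervalIntegral.integral_comp_add_left, ← intervalIntegral.integral_neg]
      refine intervalIntegral.integral_congr fun t _ => ?_
      simp only [stripIntegrand_top hk0 hk1, hwv, sub_add_cancel_left, jacobiNs_neg hk0 hk1]
      simp
    have hbot : (∫ t in (-ellipticK k)..(ellipticK k), stripIntegrand k U x t).im = 0 := by
      have hi : IntervalIntegrable (fun t : ℝ => stripIntegrand k U x t) volume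
          (-ellipticK k) (ellipticK k) := by
        refine ContinuousOn.intervalIntegrable (hcont.comp (by fun_prop) fun t ht => ?_)
        rw [uIcc_of_le (by linarith)] at ht
        refine ⟨⟨by simpa using ht, by simpa using hK'.le⟩, fun h => ?_⟩
        have := congrArg Complex.im h
        simp at this
        exact hK'.ne this
      have := Complex.imCLM.intervalIntegral_comp_comm hi
      simp only [Complex.imCLM_apply, im_stripIntegrand_ofReal hk0 hk1 hsymm] at this
      rw [← this, intervalIntegral.integral_zero]
    have hside := im_sides_stripIntegrand hk0 hk1 hUc x
    have t1 := him (-ellipticK k) (-ε) le_rfl (by linarith) (by linarith) (.inr (by linarith))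
    have t2 := him ε (ellipticK k) (by linarith) hε1.le le_rfl (.inl hε0)
    rw [← sub_eq_add_neg, ← sub_eq_add_neg] at t1
    rw [Complex.sub_im, Complex.sub_im, Complex.add_im, Complex.add_im, hbot, t1, t2] at hrect
    rw [Complex.sub_im] at hside
    simp only [Function.comp_apply]
    linarith
  · field_simp
    ring
  -- Antiperiodicity is given only in the open strip, so the endpoint η = K' is discarded as a null
  -- set; on the rest the two values of U cancel pointwise.
  · rw [correction, intervalIntegral.integral_of_le hK'.le, integral_Ioc_eq_integral_Ioo,
      setIntegral_eq_zero_of_forall_eq_zero, mul_zero]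
    intro η hη
    have h := hper (x - ellipticK k + Complex.I * η) ⟨by simpa using by linarith [hη.1],
      by simpa using hη.2⟩
    rw [show (x - ellipticK k + Complex.I * η + 2 * ellipticK k : ℂ) =
      x + ellipticK k + Complex.I * η by ring] at h
    rw [correctionIntegrand, h, neg_add_cancel, Complex.zero_re, mul_zero]
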